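/- For $n,q\in\mathbb N$, the $(n,q)$-triangle game is played on the edges of the complete graph $K_n$: in every turn Maker claims one unclaimed edge, and then Breaker claims $q$ unclaimed edges (or all remaining ones, if there are fewer than $q$). The game ends when all edges are claimed. Maker wins if he owns all three edges of a triangle; otherwise Breaker wins. Let $\deg_M(v)$, $\deg_B(v)$ denote the current number of Maker- and Breaker-edges at a node $v$. For $0<\delta<1$ put $\beta=q^2/n$, $p_0=\frac{8n}{q^2(1-\delta)(3+\delta)}$, $\mu=1+\frac{6\beta\ln n}{\delta q}$, $$\deg^*(v)=n-p_0\Big(\tfrac{q^2(1-\delta)(3+\delta)}{8}-\deg_M(v)\big(q-\tfrac{\deg_M(v)}2\big)\Big),\qquad d(v)=\deg^*(v)-\deg_B(v),$$ and let $\mathrm{pot}(v)=0$ if $\deg_M(v)+\deg_B(v)=n-1$ and $\mathrm{pot}(v)=\mu^{d(v)/q}$ otherwise; for an unclaimed edge $e=\{u,w\}$ let $\mathrm{pot}(e)=\mathrm{pot}(u)+\mathrm{pot}(w)$. Breaker's potential-based strategy with parameters $q,\delta$ is as follows. Suppose that Maker has just claimed $\{u,v\}$, and let $a$ and $b$ be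 the Maker-degrees of $u$ and $v$ before this turn. Part 1 (closing paths). Breaker claims $b$ edges incident with $u$ and $a$ edges incident with $v$ so that all new Maker-paths of length $2$ are closed (that is, every unclaimed edge joining the two ends of such a path is claimed); for paths that are already closed he claims arbitrary further edges at $u$ (at $v$, respectively) instead, and if all edges at $u$ (at $v$) are already claimed, he claims arbitrary unclaimed edges instead. (If Part 1 would need more than $q$ edges, he claims only $q$ of these.) Part 2 (free edges). As long as he has claimed fewer than $q$ edges in this turn and there are unclaimed edges, he claims one by one an unclaimed edge $e$ of maximum current potential $\mathrm{pot}(e)$. **Theorem.** Let $\varepsilon^*>0$, $0<\delta<1-\frac{8}{3(8/3+\varepsilon^*)}$ and $K\in\mathbb R$ be fixed. There is an $N$ such that for all $n\ge N$ the following hold. (i) Let $q$ be an integer with $\sqrt{(8/3+\varepsilon^*)n}\le q\le K\sqrt n$. Then Breaker can follow the strategy above throughout the game. Moreover, whenever he does so, however he makes the arbitrary choices and breaks ties, and whatever Maker does, at the end of the game no node has Maker-degree at least $q/2$, and Breaker wins the $(n,q)$-triangle game. (ii) For every integer $q\ge\sqrt{(8/3+\varepsilon^*)n}$ Breaker has a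 winning strategy in the $(n,q)$-triangle game. (Note $\sqrt{8/3}\approx1.633$.) -/

import Mathlib

namespace TriangleGame

/-! ### The game -/

/-- A position of a game on the edges of the complete graph on `Fin n`: the edges claimed by
Maker and the edges claimed by Breaker so far. -/
@[ext]
structure Position (n : ℕ) where
  maker : Finset (Sym2 (Fin n))
  breaker : Finset (Sym2 (Fin n))

namespace Position

variable {n : ℕ}

/-- The position before the first turn. -/
def initial (n : ℕ) : Position n := ⟨∅, ∅⟩

/-- The edges of the complete graph that nobody has claimed yet. -/
def unclaimed (P : Position n) : Finset (Sym2 (Fin n)) :=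
  Finset.univ.filter fun e => ¬ e.IsDiag ∧ e ∉ P.maker ∧ e ∉ P.breaker

/-- The position after Maker has claimed the edge `e`. -/
def claimMaker (P : Position n) (e : Sym2 (Fin n)) : Position n :=
  ⟨insert e P.maker, P.breaker⟩

/-- The position after Breaker has claimed all edges in `R`. -/
def claimBreaker (P : Position n) (R : Finset (Sym2 (Fin n))) : Position n :=
  ⟨P.maker, P.breaker ∪ R⟩

/-- The degree of `v` in the Maker graph. -/
def degMaker (P : Position n) (v : Fin n) : ℕ :=
  (P.maker.filter fun e => v ∈ e).card

/-- The degree of `v` in the Breaker graph. -/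
def degBreaker (P : Position n) (v : Fin n) : ℕ :=
  (P.breaker.filter fun e => v ∈ e).card

/-- Maker owns all three edges of some triangle. -/
def HasMakerTriangle (P : Position n) : Prop :=
  ¬ (SimpleGraph.fromEdgeSet (P.maker : Set (Sym2 (Fin n)))).CliqueFree 3

end Position

/-- A (history-dependent) strategy for Breaker: the set of edges that he claims in the current
turn, given the list of all edges claimed by Maker so far, the most recent one first. (Breaker's
own earlier moves are determined by the strategy and by this list.) -/
def BreakerStrategy (n : ℕ) : Type := List (Sym2 (Fin n)) → Finset (Sym2 (Fin n))

namespace BreakerStrategy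

variable {n : ℕ}

/-- The position reached when Maker has claimed the listed edges (most recent first), one per
turn, and Breaker has answered each of them according to `σ`. -/
def position (σ : BreakerStrategy n) : List (Sym2 (Fin n)) → Position n
  | [] => Position.initial n
  | e :: h => ((position σ h).claimMaker e).claimBreaker (σ (e :: h))

/-- Every edge in the list was unclaimed when Maker claimed it. -/
def IsPlay (σ : BreakerStrategy n) : List (Sym2 (Fin n)) → Prop
  | [] => True
  | e :: h => IsPlay σ h ∧ e ∈ (σ.position h).unclaimed

/-- A play at the end of the game: all edges have been claimed. -/
def IsCompletePlay (σ : BreakerStrategy n) (h : List (Sym2 (Fin n))) : Prop :=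
  σ.IsPlay h ∧ (σ.position h).unclaimed = ∅

/-- `σ` respects the rules of the game with bias `q`: in each turn Breaker claims exactly `q`
unclaimed edges, or all of them if fewer than `q` are left. -/
def IsLegal (q : ℕ) (σ : BreakerStrategy n) : Prop :=
  ∀ (h : List (Sym2 (Fin n))) (e : Sym2 (Fin n)), σ.IsPlay (e :: h) →
    σ (e :: h) ⊆ ((σ.position h).claimMaker e).unclaimed ∧
    (σ (e :: h)).card = min q ((σ.position h).claimMaker e).unclaimed.card

/-- `σ` is a winning strategy for Breaker in the `(n, q)`-triangle game: it respects the rules,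
and whatever Maker does, he owns no triangle at the end of the game. -/
def IsWinning (q : ℕ) (σ : BreakerStrategy n) : Prop :=
  σ.IsLegal q ∧ ∀ h, σ.IsCompletePlay h → ¬ (σ.position h).HasMakerTriangle

end BreakerStrategy

/-- The `(n, q)`-triangle game is Breaker's win. -/
def BreakerWins (n q : ℕ) : Prop :=
  ∃ σ : BreakerStrategy n, σ.IsWinning q

/-! ### The potential function -/

/-- The ratio `β = q² / n`, so that `q = √(β n)`. -/
noncomputable def ratio (n q : ℕ) : ℝ := (q : ℝ) ^ 2 / n

/-- The balance `p₀` of a node without claimed edges. -/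
noncomputable def startBalance (n q : ℕ) (δ : ℝ) : ℝ :=
  8 * n / ((q : ℝ) ^ 2 * (1 - δ) * (3 + δ))

/-- The base `μ` of the potential. -/
noncomputable def potBase (n q : ℕ) (δ : ℝ) : ℝ :=
  1 + 6 * ratio n q * Real.log n / (δ * q)

namespace Position

variable {n : ℕ}

/-- The balanced Breaker-degree `deg*(v)`. -/
noncomputable def balancedDeg (q : ℕ) (δ : ℝ) (P : Position n) (v : Fin n) : ℝ :=
  n - startBalance n q δ *
    ((q : ℝ) ^ 2 * (1 - δ) * (3 + δ) / 8 - P.degMaker v * (q - (P.degMaker v : ℝ) / 2))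

/-- The deficit `d(v)`. -/
noncomputable def deficit (q : ℕ) (δ : ℝ) (P : Position n) (v : Fin n) : ℝ :=
  P.balancedDeg q δ v - P.degBreaker v

/-- The potential of a node; it is `0` if all `n - 1` edges at the node are claimed. -/
noncomputable def pot (q : ℕ) (δ : ℝ) (P : Position n) (v : Fin n) : ℝ :=
  if P.degMaker v + P.degBreaker v + 1 = n then 0
  else potBase n q δ ^ (P.deficit q δ v / q)

/-- The potential of an edge: the sum of the potentials of its two end nodes. -/
noncomputable def edgePot (q : ℕ) (δ : ℝ) (P : Position n) (e : Sym2 (Fin n)) : ℝ :=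
  ∑ v ∈ e.toFinset, P.pot q δ v

/-! ### The potential-based strategy

In the next three definitions `P` is the position directly after Maker's move of the turn (and,
in `IsFreePart`, some of Breaker's answers). -/

/-- The unclaimed edges incident with `v`. -/
def unclaimedAt (P : Position n) (v : Fin n) : Finset (Sym2 (Fin n)) :=
  P.unclaimed.filter fun e => v ∈ e

/-- `H` is a possible set of closing edges with head `u`, after Maker has just claimed
`{u, v}`. It consists of `k` unclaimed edges incident with `u`, where `k` is the Maker-degree of
`v` before this turn (all unclaimed edges at `u`, if there are fewer than `k`), and closes all
Maker-paths `u, v, w` that are not closed yet. -/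
def IsHeadPart (P : Position n) (u v : Fin n) (H : Finset (Sym2 (Fin n))) : Prop :=
  H ⊆ P.unclaimedAt u ∧
  H.card = min (P.degMaker v - 1) (P.unclaimedAt u).card ∧
  ∀ w : Fin n, s(v, w) ∈ P.maker → s(u, w) ∈ P.unclaimed → s(u, w) ∈ H

/-- `C` is a possible set of edges claimed in Part 1 (closing paths), after Maker has just claimed
`{u, v}`: closing edges with head `u`, closing edges with head `v`, and, if there are not
sufficiently many unclaimed edges at `u` or at `v`, arbitrary unclaimed edges `X` instead of the
missing ones (all unclaimed edges, if these do not suffice either). -/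
def IsClosingPart (P : Position n) (u v : Fin n) (C : Finset (Sym2 (Fin n))) : Prop :=
  ∃ Hu Hv X : Finset (Sym2 (Fin n)),
    P.IsHeadPart u v Hu ∧ P.IsHeadPart v u Hv ∧
    X ⊆ P.unclaimed \ (Hu ∪ Hv) ∧
    X.card = min (((P.degMaker v - 1) - Hu.card) + ((P.degMaker u - 1) - Hv.card))
      (P.unclaimed \ (Hu ∪ Hv)).card ∧
    C = Hu ∪ Hv ∪ X

/-- `F` is a possible set of edges claimed in Part 2 (free edges) if there are `k` edges left to
claim: one after the other, Breaker claims an unclaimed edge of maximum current potential. -/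
def IsFreePart (q : ℕ) (δ : ℝ) : ℕ → Position n → Finset (Sym2 (Fin n)) → Prop
  | 0, _, F => F = ∅
  | k + 1, P, F =>
      (P.unclaimed = ∅ ∧ F = ∅) ∨
      ∃ e ∈ P.unclaimed, (∀ e' ∈ P.unclaimed, P.edgePot q δ e' ≤ P.edgePot q δ e) ∧
        ∃ F', IsFreePart q δ k (P.claimBreaker {e}) F' ∧ F = insert e F'

/-- `R` is a possible answer of the potential-based strategy with bias `q` and parameter `δ` to
Maker's edge `e`, claimed in the position `P₀`. If Part 1 would need more than `q` edges, Breaker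
claims `q` of these. -/
def IsStrategyAnswer (q : ℕ) (δ : ℝ) (P₀ : Position n) (e : Sym2 (Fin n))
    (R : Finset (Sym2 (Fin n))) : Prop :=
  ∃ (u v : Fin n) (C : Finset (Sym2 (Fin n))), e = s(u, v) ∧
    (P₀.claimMaker e).IsClosingPart u v C ∧
    ((q < C.card ∧ R ⊆ C ∧ R.card = q) ∨
     (C.card ≤ q ∧ ∃ F, IsFreePart q δ (q - C.card) ((P₀.claimMaker e).claimBreaker C) F ∧
        R = C ∪ F))

end Position

/-- Breaker follows the potential-based strategy (with some resolution of its arbitrary choices)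
in all plays. -/
def BreakerStrategy.FollowsPotential {n : ℕ} (q : ℕ) (δ : ℝ) (σ : BreakerStrategy n) : Prop :=
  ∀ (h : List (Sym2 (Fin n))) (e : Sym2 (Fin n)), σ.IsPlay (e :: h) →
    (σ.position h).IsStrategyAnswer q δ e (σ (e :: h))

end TriangleGame

/-! As long as all Maker-degrees are below `q / 2`, Part 1 needs fewer than `q` edges. Hence every
Maker-path of length two gets closed (`IsClosingPart.pathsClosed`), and no Maker-triangle can arise.
It remains to keep the Maker-degrees below `q / 2`, and the potentials serve this purpose.

A node with an unclaimed edge whose Maker-degree is about to reach `q / 2` has balanced degree about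
`p₀ * 3q² / 8`, which exceeds `n` by a multiple of `δn`, although its Breaker-degree is less than
`n`. So its potential alone exceeds `n + 1` (`lt_pot_of_le_degMaker`). Initially all deficits are 0
and the total potential is at most `n`. It therefore suffices that the total essentially never
grows.

Let Maker claim `{u, v}`, with previous Maker-degrees `x` and `y`. After Part 1 the deficit of `u`
has grown by at most `p₀(q - x - 1/2) - y`, and symmetrically at `v`. At least `q - x - y` free
moves remain. If the free edges had potential about `pot(u) + pot(v)`, they would outweigh this
growth because `p₀ < 1` (`growth_bounds`). The bound `p₀ < 1` is where the threshold `8/3` enters.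

The free edges may have lower potential, but then the maximum edge potential has dropped. With `m` a
bound for all edge potentials and `η = δ / 4`, the quantity "total potential plus `η / 8 * m`"
therefore never increases (`IsStrategyAnswer.potential_step`). Extra Breaker-edges only lower
potentials, so for a large bias Breaker plays the strategy of a smaller bias and adds arbitrary
edges (`exists_extends_potential`). -/

namespace TriangleGame

/-! ### Positions, degrees and closed paths -/

namespace Position

variable {n : ℕ}

/-- No loop is claimed, and no edge is claimed by both players. -/
structure Valid (P : Position n) : Prop where
  maker_not_diag : ∀ e ∈ P.maker, ¬ e.IsDiag
  breaker_not_diag : ∀ e ∈ P.breaker, ¬ e.IsDiag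
  disjoint : Disjoint P.maker P.breaker

/-- The ends of every Maker-path of length two are joined by a Breaker-edge. -/
def PathsClosed (P : Position n) : Prop :=
  ∀ u v w : Fin n, u ≠ w → s(u, v) ∈ P.maker → s(v, w) ∈ P.maker → s(u, w) ∈ P.breaker

theorem mem_unclaimed {P : Position n} {e : Sym2 (Fin n)} :
    e ∈ P.unclaimed ↔ ¬ e.IsDiag ∧ e ∉ P.maker ∧ e ∉ P.breaker := by
  simp [unclaimed]

theorem mem_unclaimedAt {P : Position n} {v : Fin n} {e : Sym2 (Fin n)} :
    e ∈ P.unclaimedAt v ↔ e ∈ P.unclaimed ∧ v ∈ e := by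
  simp [unclaimedAt]

theorem valid_initial : (initial n).Valid := ⟨by simp [initial], by simp [initial], by simp [initial]⟩

theorem Valid.claimMaker {P : Position n} (hP : P.Valid) {e : Sym2 (Fin n)}
    (he : e ∈ P.unclaimed) : (P.claimMaker e).Valid := by
  rw [mem_unclaimed] at he
  refine ⟨?_, hP.breaker_not_diag, ?_⟩
  · intro f hf
    rcases Finset.mem_insert.1 hf with rfl | hf
    · exact he.1
    · exact hP.maker_not_diag f hf
  · exact Finset.disjoint_insert_left.2 ⟨he.2.2, hP.disjoint⟩

theorem Valid.claimBreaker {P : Position n} (hP : P.Valid) {R : Finset (Sym2 (Fin n))}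
    (hR : R ⊆ P.unclaimed) : (P.claimBreaker R).Valid := by
  refine ⟨hP.maker_not_diag, ?_, ?_⟩
  · intro f hf
    rcases Finset.mem_union.1 hf with hf | hf
    · exact hP.breaker_not_diag f hf
    · exact (mem_unclaimed.1 (hR hf)).1
  · refine Finset.disjoint_union_right.2 ⟨hP.disjoint, ?_⟩
    exact Finset.disjoint_right.2 fun f hf => (mem_unclaimed.1 (hR hf)).2.1

theorem claimBreaker_claimBreaker (P : Position n) (R S : Finset (Sym2 (Fin n))) :
    (P.claimBreaker R).claimBreaker S = P.claimBreaker (R ∪ S) := by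
  simp [claimBreaker, Finset.union_assoc]

theorem unclaimed_claimBreaker (P : Position n) (R : Finset (Sym2 (Fin n))) :
    (P.claimBreaker R).unclaimed = P.unclaimed \ R := by
  ext f
  simp only [mem_unclaimed, Finset.mem_sdiff, claimBreaker, Finset.mem_union]
  tauto

theorem unclaimed_claimMaker_subset (P : Position n) (e : Sym2 (Fin n)) :
    (P.claimMaker e).unclaimed ⊆ P.unclaimed := by
  intro f
  simp only [mem_unclaimed, claimMaker, Finset.mem_insert]
  tauto

theorem unclaimedAt_claimBreaker_subset (P : Position n) (R : Finset (Sym2 (Fin n))) (v : Fin n) :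
    (P.claimBreaker R).unclaimedAt v ⊆ P.unclaimedAt v := by
  intro f
  simp only [mem_unclaimedAt, unclaimed_claimBreaker, Finset.mem_sdiff]
  tauto

theorem card_filter_not_isDiag_mem (v : Fin n) :
    (Finset.univ.filter fun e : Sym2 (Fin n) => ¬ e.IsDiag ∧ v ∈ e).card + 1 = n := by
  have h : (Finset.univ.filter fun e : Sym2 (Fin n) => ¬ e.IsDiag ∧ v ∈ e) =
      (Finset.univ.erase v).image fun w => s(v, w) := by
    ext e
    induction e with | _ x y =>
    simp only [Finset.mem_filter, Finset.mem_univ, true_and, Sym2.mk_isDiag_iff, Sym2.mem_iff,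
      Finset.mem_image, Finset.mem_erase, and_true, Sym2.eq_iff]
    constructor
    · rintro ⟨h, rfl | rfl⟩
      · exact ⟨y, Ne.symm h, by simp⟩
      · exact ⟨x, h, by simp⟩
    · rintro ⟨w, hw, ⟨rfl, rfl⟩ | ⟨rfl, rfl⟩⟩
      · exact ⟨Ne.symm hw, by simp⟩
      · exact ⟨hw, by simp⟩
  rw [h, Finset.card_image_of_injective _ fun a b hab => Sym2.congr_right.1 hab,
    Finset.card_erase_of_mem (Finset.mem_univ _), Finset.card_univ, Fintype.card_fin]
  have := v.pos
  omega

theorem Valid.degree_sum {P : Position n} (hP : P.Valid) (v : Fin n) :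
    P.degMaker v + P.degBreaker v + (P.unclaimedAt v).card + 1 = n := by
  have h : (Finset.univ.filter fun e : Sym2 (Fin n) => ¬ e.IsDiag ∧ v ∈ e) =
      ((P.maker.filter fun e => v ∈ e) ∪ P.breaker.filter fun e => v ∈ e) ∪ P.unclaimedAt v := by
    ext e
    have h1 := hP.maker_not_diag e
    have h2 := hP.breaker_not_diag e
    simp only [Finset.mem_filter, Finset.mem_univ, true_and, Finset.mem_union, mem_unclaimedAt,
      mem_unclaimed]
    tauto
  have hcard := card_filter_not_isDiag_mem v
  rw [h, Finset.card_union_of_disjoint, Finset.card_union_of_disjoint] at hcard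
  · exact hcard
  · exact Finset.disjoint_filter_filter hP.disjoint
  · rw [Finset.disjoint_left]
    intro e
    simp only [Finset.mem_filter, Finset.mem_union, mem_unclaimedAt, mem_unclaimed]
    tauto

theorem Valid.full_iff {P : Position n} (hP : P.Valid) (v : Fin n) :
    P.degMaker v + P.degBreaker v + 1 = n ↔ P.unclaimedAt v = ∅ := by
  have := hP.degree_sum v
  rw [← Finset.card_eq_zero]
  omega

theorem degMaker_claimMaker_of_mem {P : Position n} {e : Sym2 (Fin n)} (he : e ∈ P.unclaimed)
    {v : Fin n} (hv : v ∈ e) : (P.claimMaker e).degMaker v = P.degMaker v + 1 := by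
  rw [degMaker, claimMaker, Finset.filter_insert, if_pos hv, Finset.card_insert_of_notMem]
  · rfl
  · simp [(mem_unclaimed.1 he).2.1]

theorem degMaker_claimMaker_of_notMem {P : Position n} {e : Sym2 (Fin n)}
    {v : Fin n} (hv : v ∉ e) : (P.claimMaker e).degMaker v = P.degMaker v := by
  rw [degMaker, claimMaker, Finset.filter_insert, if_neg hv]
  rfl

theorem degBreaker_claimBreaker {P : Position n} {R : Finset (Sym2 (Fin n))}
    (hR : R ⊆ P.unclaimed) (v : Fin n) :
    (P.claimBreaker R).degBreaker v = P.degBreaker v + (R.filter fun e => v ∈ e).card := by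
  rw [degBreaker, claimBreaker, Finset.filter_union, Finset.card_union_of_disjoint]
  · rfl
  · refine Finset.disjoint_filter_filter (Finset.disjoint_right.2 fun f hf => ?_)
    exact (mem_unclaimed.1 (hR hf)).2.2

theorem PathsClosed.not_hasMakerTriangle {P : Position n} (h : P.PathsClosed) (hP : P.Valid) :
    ¬ P.HasMakerTriangle := by
  intro ht
  apply ht
  intro t hc
  obtain ⟨a, b, c, hab, hac, hbc, -⟩ := SimpleGraph.is3Clique_iff.1 hc
  simp only [SimpleGraph.fromEdgeSet_adj, Finset.mem_coe] at hab hac hbc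
  exact Finset.disjoint_left.1 hP.disjoint hac.1 (h a b c hac.2 hab.1 hbc.1)

/-! ### The structure of the answers -/

theorem IsHeadPart.subset {P : Position n} {u v : Fin n} {H : Finset (Sym2 (Fin n))}
    (h : P.IsHeadPart u v H) : H ⊆ P.unclaimed :=
  h.1.trans (Finset.filter_subset _ _)

/-- The edges that must be claimed, collected in `T`, lead from `u` to Maker-neighbours of `v` other
than `u`. There are `P.degMaker v - 1` of these, so `T` fits into the prescribed size. -/
theorem IsHeadPart.exists {P : Position n} {u v : Fin n} (huv : s(u, v) ∈ P.maker) :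
    ∃ H, P.IsHeadPart u v H := by
  set T : Finset (Sym2 (Fin n)) :=
    (P.unclaimed.filter fun e => ∃ w, s(v, w) ∈ P.maker ∧ e = s(u, w)) with hT
  have hTu : T ⊆ P.unclaimedAt u := by
    intro e he
    obtain ⟨h1, w, -, rfl⟩ := Finset.mem_filter.1 he
    exact mem_unclaimedAt.2 ⟨h1, by simp⟩
  have hTc : T.card ≤ P.degMaker v - 1 := by
    have h1 : T ⊆ (Finset.univ.filter fun w => s(v, w) ∈ P.maker ∧ w ≠ u).image
        fun w => s(u, w) := by
      intro e he
      obtain ⟨h1, w, hw, rfl⟩ := Finset.mem_filter.1 he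
      refine Finset.mem_image.2 ⟨w, ?_, rfl⟩
      simp only [Finset.mem_filter, Finset.mem_univ, true_and]
      refine ⟨hw, ?_⟩
      rintro rfl
      exact (mem_unclaimed.1 h1).1 (by simp)
    have h2 : ((Finset.univ.filter fun w => s(v, w) ∈ P.maker ∧ w ≠ u).image
        fun w => s(v, w)) ⊆ (P.maker.filter fun e => v ∈ e).erase s(u, v) := by
      intro e he
      obtain ⟨w, hw, rfl⟩ := Finset.mem_image.1 he
      simp only [Finset.mem_filter, Finset.mem_univ, true_and] at hw
      refine Finset.mem_erase.2 ⟨?_, Finset.mem_filter.2 ⟨hw.1, by simp⟩⟩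
      intro h
      rw [Sym2.eq_swap (a := u)] at h
      exact hw.2 (Sym2.congr_right.1 h)
    have h3 := Finset.card_le_card h2
    rw [Finset.card_image_of_injective _ fun a b hab => Sym2.congr_right.1 hab,
      Finset.card_erase_of_mem (Finset.mem_filter.2 ⟨huv, by simp⟩)] at h3
    exact (Finset.card_le_card h1).trans (Finset.card_image_le.trans h3)
  obtain ⟨H, hTH, hHu, hHc⟩ := Finset.exists_subsuperset_card_eq hTu
    (n := min (P.degMaker v - 1) (P.unclaimedAt u).card)
    (le_min hTc (Finset.card_le_card hTu)) (min_le_right _ _)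
  exact ⟨H, hHu, hHc, fun w hw hw' => hTH (Finset.mem_filter.2 ⟨hw', w, hw, rfl⟩)⟩

theorem IsClosingPart.exists {P : Position n} {u v : Fin n}
    (huv : s(u, v) ∈ P.maker) : ∃ C, P.IsClosingPart u v C := by
  obtain ⟨Hu, hHu⟩ := IsHeadPart.exists huv
  obtain ⟨Hv, hHv⟩ := IsHeadPart.exists (Sym2.eq_swap (a := u) ▸ huv)
  obtain ⟨X, hX, hXc⟩ := Finset.exists_subset_card_eq (s := P.unclaimed \ (Hu ∪ Hv))
    (n := min (((P.degMaker v - 1) - Hu.card) + ((P.degMaker u - 1) - Hv.card))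
      (P.unclaimed \ (Hu ∪ Hv)).card) (min_le_right _ _)
  exact ⟨_, Hu, Hv, X, hHu, hHv, hX, hXc, rfl⟩

theorem IsClosingPart.subset {P : Position n} {u v : Fin n} {C : Finset (Sym2 (Fin n))}
    (h : P.IsClosingPart u v C) : C ⊆ P.unclaimed := by
  obtain ⟨Hu, Hv, X, hHu, hHv, hX, -, rfl⟩ := h
  exact Finset.union_subset (Finset.union_subset hHu.subset hHv.subset)
    (hX.trans Finset.sdiff_subset)

theorem IsClosingPart.card_le {P : Position n} {u v : Fin n} {C : Finset (Sym2 (Fin n))}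
    (h : P.IsClosingPart u v C) : C.card ≤ (P.degMaker v - 1) + (P.degMaker u - 1) := by
  obtain ⟨Hu, Hv, X, hHu, hHv, -, hXc, rfl⟩ := h
  have h1 := Finset.card_union_le (Hu ∪ Hv) X
  have h2 := Finset.card_union_le Hu Hv
  have h3 := hHu.2.1
  have h4 := hHv.2.1
  omega

theorem IsFreePart.exists (q : ℕ) (δ : ℝ) (k : ℕ) (P : Position n) :
    ∃ F, IsFreePart q δ k P F := by
  induction k generalizing P with
  | zero => exact ⟨∅, rfl⟩
  | succ k ih =>
    rcases P.unclaimed.eq_empty_or_nonempty with h | h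
    · exact ⟨∅, Or.inl ⟨h, rfl⟩⟩
    · obtain ⟨e, he, hmax⟩ := P.unclaimed.exists_max_image (P.edgePot q δ) h
      obtain ⟨F', hF'⟩ := ih (P.claimBreaker {e})
      exact ⟨_, Or.inr ⟨e, he, hmax, F', hF', rfl⟩⟩

theorem IsFreePart.subset_and_card {q : ℕ} {δ : ℝ} {k : ℕ} {P : Position n}
    {F : Finset (Sym2 (Fin n))} (h : IsFreePart q δ k P F) :
    F ⊆ P.unclaimed ∧ F.card = min k P.unclaimed.card := by
  induction k generalizing P F with
  | zero =>
    obtain rfl : F = ∅ := h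
    simp
  | succ k ih =>
    rcases h with ⟨h, rfl⟩ | ⟨e, he, -, F', hF', rfl⟩
    · simp [h]
    · obtain ⟨h1, h2⟩ := ih hF'
      rw [unclaimed_claimBreaker, Finset.sdiff_singleton_eq_erase] at h1 h2
      have heF : e ∉ F' := fun h => Finset.notMem_erase e _ (h1 h)
      refine ⟨Finset.insert_subset he (h1.trans (Finset.erase_subset _ _)), ?_⟩
      rw [Finset.card_insert_of_notMem heF, h2, Finset.card_erase_of_mem he]
      have := Finset.card_pos.2 ⟨e, he⟩
      omega

theorem IsStrategyAnswer.exists (q : ℕ) (δ : ℝ) (P : Position n) (e : Sym2 (Fin n)) :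
    ∃ R, P.IsStrategyAnswer q δ e R := by
  induction e with | _ u v =>
  obtain ⟨C, hC⟩ := IsClosingPart.exists (P := P.claimMaker s(u, v)) (u := u) (v := v)
    (Finset.mem_insert_self _ _)
  by_cases hq : q < C.card
  · obtain ⟨R, hR, hRc⟩ := Finset.exists_subset_card_eq hq.le
    exact ⟨R, u, v, C, rfl, hC, Or.inl ⟨hq, hR, hRc⟩⟩
  · obtain ⟨F, hF⟩ := IsFreePart.exists q δ (q - C.card)
      ((P.claimMaker s(u, v)).claimBreaker C)
    exact ⟨_, u, v, C, rfl, hC, Or.inr ⟨not_lt.1 hq, F, hF, rfl⟩⟩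

theorem IsStrategyAnswer.subset_and_card {q : ℕ} {δ : ℝ} {P : Position n} {e : Sym2 (Fin n)}
    {R : Finset (Sym2 (Fin n))} (h : P.IsStrategyAnswer q δ e R) :
    R ⊆ (P.claimMaker e).unclaimed ∧ R.card = min q (P.claimMaker e).unclaimed.card := by
  obtain ⟨u, v, C, rfl, hC, ⟨hq, hR, hRc⟩ | ⟨hq, F, hF, rfl⟩⟩ := h
  · have h1 := Finset.card_le_card hC.subset
    exact ⟨hR.trans hC.subset, by omega⟩
  · obtain ⟨h1, h2⟩ := hF.subset_and_card
    rw [unclaimed_claimBreaker] at h1 h2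
    have hd : Disjoint C F := Finset.disjoint_right.2 fun f hf => (Finset.mem_sdiff.1 (h1 hf)).2
    refine ⟨Finset.union_subset hC.subset (h1.trans Finset.sdiff_subset), ?_⟩
    rw [Finset.card_union_of_disjoint hd, h2, Finset.card_sdiff_of_subset hC.subset]
    have := Finset.card_le_card hC.subset
    omega

/-! ### Closing the new paths -/

theorem IsHeadPart.mem_breaker_or_mem {P : Position n} (hP : P.Valid) (hc : P.PathsClosed)
    {u v : Fin n} (he : s(u, v) ∈ P.unclaimed) {H : Finset (Sym2 (Fin n))}
    (hH : (P.claimMaker s(u, v)).IsHeadPart u v H) {w : Fin n} (hwu : u ≠ w)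
    (hw : s(v, w) ∈ P.maker) : s(u, w) ∈ P.breaker ∪ H := by
  rw [Finset.mem_union]
  by_cases hb : s(u, w) ∈ P.breaker
  · exact Or.inl hb
  refine Or.inr (hH.2.2 w (Finset.mem_insert_of_mem hw) (mem_unclaimed.2 ⟨by simpa using hwu, ?_, hb⟩))
  intro hm
  obtain ⟨hd, -, hub⟩ := mem_unclaimed.1 he
  rcases Finset.mem_insert.1 hm with h | h
  · obtain rfl : w = v := Sym2.congr_right.1 h
    exact hP.maker_not_diag _ hw (by simp)
  -- If `{u, w}` were a Maker-edge, then the path `u, w, v` would already be closed, so `{u, v}`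
  -- would have been a Breaker-edge.
  · exact hub (hc u w v (by simpa using hd) h (Sym2.eq_swap (a := v) ▸ hw))

theorem IsClosingPart.pathsClosed {P : Position n} (hP : P.Valid) (hc : P.PathsClosed)
    {u v : Fin n} (he : s(u, v) ∈ P.unclaimed) {C : Finset (Sym2 (Fin n))}
    (hC : (P.claimMaker s(u, v)).IsClosingPart u v C) :
    ((P.claimMaker s(u, v)).claimBreaker C).PathsClosed := by
  obtain ⟨Hu, Hv, X, hHu, hHv, -, -, rfl⟩ := hC
  have hu : ∀ w, u ≠ w → s(v, w) ∈ P.maker → s(u, w) ∈ P.breaker ∪ (Hu ∪ Hv ∪ X) := by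
    intro w h1 h2
    have := hHu.mem_breaker_or_mem hP hc he h1 h2
    simp only [Finset.mem_union] at this ⊢
    tauto
  have hv : ∀ w, v ≠ w → s(u, w) ∈ P.maker → s(v, w) ∈ P.breaker ∪ (Hu ∪ Hv ∪ X) := by
    intro w h1 h2
    rw [Sym2.eq_swap] at he hHv
    have := hHv.mem_breaker_or_mem hP hc he h1 h2
    simp only [Finset.mem_union] at this ⊢
    tauto
  intro x y z hxz hxy hyz
  change s(x, z) ∈ P.breaker ∪ (Hu ∪ Hv ∪ X)
  rcases Finset.mem_insert.1 hxy with h1 | h1 <;> rcases Finset.mem_insert.1 hyz with h2 | h2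
  · refine absurd (Sym2.congr_right.1 (?_ : s(y, x) = s(y, z))) hxz
    rw [Sym2.eq_swap, h1, h2]
  · rcases Sym2.eq_iff.1 h1 with ⟨rfl, rfl⟩ | ⟨rfl, rfl⟩
    · exact hu z hxz h2
    · exact hv z hxz h2
  · rw [Sym2.eq_swap] at h1 ⊢
    rcases Sym2.eq_iff.1 h2 with ⟨rfl, rfl⟩ | ⟨rfl, rfl⟩
    · exact hv x hxz.symm h1
    · exact hu x hxz.symm h1
  · exact Finset.mem_union_left _ (hc x y z hxz h1 h2)

theorem PathsClosed.claimBreaker {P : Position n} (hc : P.PathsClosed)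
    (R : Finset (Sym2 (Fin n))) : (P.claimBreaker R).PathsClosed :=
  fun u v w huw h1 h2 => Finset.mem_union_left _ (hc u v w huw h1 h2)

/-! ### Changes of the potentials -/

/-- The sum of the potentials of all nodes. -/
noncomputable def totalPot (q : ℕ) (δ : ℝ) (P : Position n) : ℝ := ∑ v, P.pot q δ v

theorem edgePot_mk (q : ℕ) (δ : ℝ) (P : Position n) {u v : Fin n} (h : u ≠ v) :
    P.edgePot q δ s(u, v) = P.pot q δ u + P.pot q δ v := by
  rw [edgePot, Sym2.toFinset_mk_eq, Finset.sum_pair h]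

section

variable {q : ℕ} {δ : ℝ}

theorem pot_nonneg (hμ : 1 ≤ potBase n q δ) (P : Position n) (v : Fin n) : 0 ≤ P.pot q δ v := by
  unfold pot
  split_ifs
  · exact le_rfl
  · exact Real.rpow_nonneg (by linarith) _

theorem edgePot_nonneg (hμ : 1 ≤ potBase n q δ) (P : Position n) (e : Sym2 (Fin n)) :
    0 ≤ P.edgePot q δ e :=
  Finset.sum_nonneg fun _ _ => pot_nonneg hμ P _

theorem pot_eq_rpow {P : Position n} (hP : P.Valid) {e : Sym2 (Fin n)} (he : e ∈ P.unclaimed)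
    {v : Fin n} (hv : v ∈ e) : P.pot q δ v = potBase n q δ ^ (P.deficit q δ v / q) := by
  rw [pot, if_neg]
  rw [hP.full_iff]
  exact Finset.ne_empty_of_mem (mem_unclaimedAt.2 ⟨he, hv⟩)

theorem pot_eq_zero {P : Position n} (hP : P.Valid) {v : Fin n} (hv : P.unclaimedAt v = ∅) :
    P.pot q δ v = 0 := by
  rw [pot, if_pos ((hP.full_iff v).2 hv)]

/-- Each new Breaker-edge at `v` lowers the deficit by 1. If `v` becomes full, its potential is 0
and the bound holds for every `k`; this covers nodes with too few unclaimed edges for Part 1. -/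
theorem pot_claimBreaker_le (hμ : 1 ≤ potBase n q δ) {P : Position n} (hP : P.Valid)
    {R : Finset (Sym2 (Fin n))} (hR : R ⊆ P.unclaimed) (v : Fin n) {k : ℕ}
    (hk : (P.claimBreaker R).unclaimedAt v = ∅ ∨ k ≤ (R.filter fun e => v ∈ e).card) :
    (P.claimBreaker R).pot q δ v ≤ P.pot q δ v * potBase n q δ ^ (-(k : ℝ) / q) := by
  have hpos : 0 < potBase n q δ := by linarith
  have hrhs : 0 ≤ P.pot q δ v * potBase n q δ ^ (-(k : ℝ) / q) :=
    mul_nonneg (pot_nonneg hμ P v) (Real.rpow_nonneg hpos.le _)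
  rcases ((P.claimBreaker R).unclaimedAt v).eq_empty_or_nonempty with h | ⟨e, he⟩
  · rwa [pot_eq_zero (hP.claimBreaker hR) h]
  · have hk : k ≤ (R.filter fun e => v ∈ e).card :=
      hk.resolve_left (Finset.ne_empty_of_mem he)
    have he' := mem_unclaimedAt.1 (unclaimedAt_claimBreaker_subset P R v he)
    rw [mem_unclaimedAt] at he
    rw [pot_eq_rpow (hP.claimBreaker hR) he.1 he.2, pot_eq_rpow hP he'.1 he'.2,
      ← Real.rpow_add hpos]
    refine Real.rpow_le_rpow_of_exponent_le hμ ?_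
    rw [← add_div]
    refine div_le_div_of_nonneg_right ?_ (Nat.cast_nonneg q)
    rw [deficit, deficit, degBreaker_claimBreaker hR]
    have : (k : ℝ) ≤ (R.filter fun e => v ∈ e).card := by exact_mod_cast hk
    push_cast
    change P.balancedDeg q δ v - _ ≤ _
    linarith

theorem pot_claimBreaker_le_pot (hμ : 1 ≤ potBase n q δ) {P : Position n} (hP : P.Valid)
    {R : Finset (Sym2 (Fin n))} (hR : R ⊆ P.unclaimed) (v : Fin n) :
    (P.claimBreaker R).pot q δ v ≤ P.pot q δ v := by
  simpa using pot_claimBreaker_le (k := 0) hμ hP hR v (Or.inr (Nat.zero_le _))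

theorem edgePot_claimBreaker_le (hμ : 1 ≤ potBase n q δ) {P : Position n} (hP : P.Valid)
    {R : Finset (Sym2 (Fin n))} (hR : R ⊆ P.unclaimed) (e : Sym2 (Fin n)) :
    (P.claimBreaker R).edgePot q δ e ≤ P.edgePot q δ e :=
  Finset.sum_le_sum fun v _ => pot_claimBreaker_le_pot hμ hP hR v

theorem totalPot_claimBreaker_le (hμ : 1 ≤ potBase n q δ) {P : Position n} (hP : P.Valid)
    {R : Finset (Sym2 (Fin n))} (hR : R ⊆ P.unclaimed) :
    (P.claimBreaker R).totalPot q δ ≤ P.totalPot q δ :=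
  Finset.sum_le_sum fun v _ => pot_claimBreaker_le_pot hμ hP hR v

theorem pot_claimMaker_of_notMem (P : Position n) {e : Sym2 (Fin n)} {v : Fin n} (hv : v ∉ e) :
    (P.claimMaker e).pot q δ v = P.pot q δ v := by
  simp only [pot, deficit, balancedDeg, degMaker_claimMaker_of_notMem hv]
  rfl

/-- When `x` increases by 1, the term `x (q - x / 2)` of the balanced degree increases by `q - x - 1
/ 2`. -/
theorem pot_claimMaker_le (hμ : 1 ≤ potBase n q δ) {P : Position n} (hP : P.Valid)
    {e : Sym2 (Fin n)} (he : e ∈ P.unclaimed) {v : Fin n} (hv : v ∈ e) :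
    (P.claimMaker e).pot q δ v ≤ P.pot q δ v * potBase n q δ ^
      (startBalance n q δ * (q - P.degMaker v - 1 / 2) / q) := by
  have hpos : 0 < potBase n q δ := by linarith
  rcases ((P.claimMaker e).unclaimedAt v).eq_empty_or_nonempty with h | ⟨f, hf⟩
  · rw [pot_eq_zero (hP.claimMaker he) h]
    exact mul_nonneg (pot_nonneg hμ P v) (Real.rpow_nonneg hpos.le _)
  · rw [mem_unclaimedAt] at hf
    rw [pot_eq_rpow (hP.claimMaker he) hf.1 hf.2, pot_eq_rpow hP he hv, ← Real.rpow_add hpos,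
      ← add_div]
    refine Real.rpow_le_rpow_of_exponent_le hμ
      (div_le_div_of_nonneg_right (le_of_eq ?_) (Nat.cast_nonneg q))
    rw [deficit, deficit, balancedDeg, balancedDeg, degMaker_claimMaker_of_mem he hv]
    change _ - (P.degBreaker v : ℝ) = _
    push_cast
    ring

/-- If the head part falls short of its nominal size, it has used up all unclaimed edges at `u`. -/
theorem IsHeadPart.le_card_filter {P : Position n} {u v : Fin n} {H R : Finset (Sym2 (Fin n))}
    (hH : P.IsHeadPart u v H) (hHR : H ⊆ R) :
    (P.claimBreaker R).unclaimedAt u = ∅ ∨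
      P.degMaker v - 1 ≤ (R.filter fun e => u ∈ e).card := by
  have hsub : H ⊆ R.filter fun e => u ∈ e := fun e he =>
    Finset.mem_filter.2 ⟨hHR he, (mem_unclaimedAt.1 (hH.1 he)).2⟩
  rcases le_total (P.degMaker v - 1) (P.unclaimedAt u).card with h | h
  · right
    rw [← min_eq_left h, ← hH.2.1]
    exact Finset.card_le_card hsub
  · left
    have hc : (P.unclaimedAt u).card ≤ H.card := by rw [hH.2.1, min_eq_right h]
    have hHe := Finset.eq_of_subset_of_card_le hH.1 hc
    rw [Finset.eq_empty_iff_forall_notMem]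
    intro e he
    have h1 := unclaimedAt_claimBreaker_subset P R u he
    rw [← hHe] at h1
    rw [mem_unclaimedAt, unclaimed_claimBreaker, Finset.mem_sdiff] at he
    exact he.1.2 (hHR h1)

theorem IsHeadPart.pot_le (hμ : 1 ≤ potBase n q δ) {P : Position n} (hP : P.Valid)
    {u v : Fin n} (he : s(u, v) ∈ P.unclaimed) {H R : Finset (Sym2 (Fin n))}
    (hH : (P.claimMaker s(u, v)).IsHeadPart u v H) (hHR : H ⊆ R)
    (hR : R ⊆ (P.claimMaker s(u, v)).unclaimed) :
    ((P.claimMaker s(u, v)).claimBreaker R).pot q δ u ≤ P.pot q δ u * potBase n q δ ^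
      ((startBalance n q δ * (q - P.degMaker u - 1 / 2) - P.degMaker v) / q) := by
  have hpos : 0 < potBase n q δ := by linarith
  have h1 := pot_claimBreaker_le (δ := δ) (q := q) hμ (hP.claimMaker he) hR u
    (hH.le_card_filter hHR)
  have h2 := pot_claimMaker_le (δ := δ) (q := q) hμ hP he (v := u) (by simp)
  rw [degMaker_claimMaker_of_mem he (v := v) (by simp), Nat.add_sub_cancel] at h1
  refine h1.trans ((mul_le_mul_of_nonneg_right h2 (Real.rpow_nonneg hpos.le _)).trans ?_)
  rw [mul_assoc, ← Real.rpow_add hpos, ← add_div, ← sub_eq_add_neg]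

/-- Potentials do not rise during Part 2, and each claimed edge is maximal when chosen. Some `m`
thus bounds all remaining edges from above and all claimed ones from below. Each claim multiplies
the potentials of the two ends by at most `μ ^ (-1 / q)`. -/
theorem IsFreePart.exists_bound (hμ : 1 ≤ potBase n q δ) {k : ℕ} {P : Position n} (hP : P.Valid)
    {F : Finset (Sym2 (Fin n))} (hF : IsFreePart q δ k P F) :
    ∃ m : ℝ, 0 ≤ m ∧ (∀ e ∈ (P.claimBreaker F).unclaimed, (P.claimBreaker F).edgePot q δ e ≤ m) ∧
      (P.claimBreaker F).totalPot q δ ≤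
        P.totalPot q δ - k * (1 - potBase n q δ ^ (-1 / q : ℝ)) * m := by
  have hpos : 0 < potBase n q δ := by linarith
  have hz : 0 ≤ 1 - potBase n q δ ^ (-1 / q : ℝ) :=
    sub_nonneg.2 (Real.rpow_le_one_of_one_le_of_nonpos hμ
      (div_nonpos_of_nonpos_of_nonneg (by norm_num) (Nat.cast_nonneg q)))
  induction k generalizing P F with
  | zero =>
    have hle := totalPot_claimBreaker_le (δ := δ) (q := q) hμ hP hF.subset_and_card.1
    -- No drop is required for `k = 0`, so any upper bound serves.
    refine ⟨∑ e, (P.claimBreaker F).edgePot q δ e,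
      Finset.sum_nonneg fun e _ => edgePot_nonneg hμ _ e, fun e _ => ?_, by simpa using hle⟩
    exact Finset.single_le_sum (f := (P.claimBreaker F).edgePot q δ)
      (fun e _ => edgePot_nonneg hμ _ e) (Finset.mem_univ e)
  | succ k ih =>
    have hle := totalPot_claimBreaker_le (δ := δ) (q := q) hμ hP hF.subset_and_card.1
    rcases hF with ⟨h, rfl⟩ | ⟨e, he, hmax, F', hF', rfl⟩
    -- No unclaimed edge is left to be bounded, and `m = 0` makes the required drop vanish even
    -- though fewer than `k` edges are claimed.
    · refine ⟨0, le_rfl, fun e he => ?_, by simpa using hle⟩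
      rw [unclaimed_claimBreaker, h] at he
      simp at he
    · have heP : {e} ⊆ P.unclaimed := Finset.singleton_subset_iff.2 he
      obtain ⟨m, hm, hb, hm'⟩ := ih (hP.claimBreaker heP) hF'
      have hF'P := hF'.subset_and_card.1
      rw [claimBreaker_claimBreaker, ← Finset.insert_eq] at hb hm'
      have hins : insert e F' ⊆ P.unclaimed := by
        refine Finset.insert_subset he (hF'P.trans ?_)
        rw [unclaimed_claimBreaker]
        exact Finset.sdiff_subset
      refine ⟨min m (P.edgePot q δ e), le_min hm (edgePot_nonneg hμ P e), fun f hf => ?_, ?_⟩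
      · refine le_min (hb f hf) ((edgePot_claimBreaker_le hμ hP hins f).trans (hmax f ?_))
        rw [unclaimed_claimBreaker] at hf
        exact (Finset.mem_sdiff.1 hf).1
      · have hone : (P.claimBreaker {e}).totalPot q δ ≤ P.totalPot q δ -
            (1 - potBase n q δ ^ (-1 / q : ℝ)) * P.edgePot q δ e := by
          have hnode : ∀ v, (P.claimBreaker {e}).pot q δ v ≤ P.pot q δ v -
              if v ∈ e.toFinset then (1 - potBase n q δ ^ (-1 / q : ℝ)) * P.pot q δ v else 0 := by
            intro v
            split_ifs with hv
            · have := pot_claimBreaker_le (δ := δ) (q := q) (k := 1) hμ hP heP v (Or.inr (by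
                rw [Finset.filter_singleton, if_pos (Sym2.mem_toFinset.1 hv)]
                simp))
              push_cast at this
              linarith
            · simpa using pot_claimBreaker_le_pot hμ hP heP v
          refine (Finset.sum_le_sum fun v _ => hnode v).trans_eq ?_
          rw [Finset.sum_sub_distrib, Finset.sum_ite_mem, Finset.univ_inter, ← Finset.mul_sum]
          rfl
        have h1 := mul_le_mul_of_nonneg_left (min_le_left m (P.edgePot q δ e))
          (mul_nonneg (Nat.cast_nonneg k) hz)
        have h2 := mul_le_mul_of_nonneg_left (min_le_right m (P.edgePot q δ e)) hz
        push_cast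
        linarith

end

/-! ### One turn -/

theorem exp_mul_le {l y : ℝ} (hl₀ : 0 ≤ l) (hl₁ : l ≤ 1) (hy : |y| ≤ 1) :
    Real.exp (l * y) ≤ 1 + l * y + l ^ 2 := by
  have hly : |l * y| ≤ l := by
    rw [abs_mul, abs_of_nonneg hl₀]
    exact mul_le_of_le_one_right hl₀ hy
  have h1 := (abs_le.1 (Real.abs_exp_sub_one_sub_id_le (hly.trans hl₁))).2
  have h2 : (l * y) ^ 2 ≤ l ^ 2 := sq_le_sq' (by linarith [neg_abs_le (l * y)]) ((le_abs_self _).trans hly)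
  linarith

/-- Here `l = log μ`, and `x`, `y` are the Maker-degrees of the two ends. The second bound compares
the relative growth at one end with the drop caused by `q - x - y` free edges whose potential is at
least `1 - η / 8` times that of Maker's edge. -/
theorem growth_bounds {l p η x y q : ℝ} (hq : 1 ≤ q) (hη : 0 < η) (hη₁ : η ≤ 1) (hl₀ : 0 < l)
    (hl : l ≤ η ^ 2 / 128) (hp₀ : 0 ≤ p) (hp : p ≤ 1 - η) (hx₀ : 0 ≤ x) (hx : x ≤ q / 2)
    (hy₀ : 0 ≤ y) (hy : y ≤ q / 2) :
    Real.exp (l * ((p * (q - x - 1 / 2) - y) / q)) ≤ 1 + 2 * l ∧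
    Real.exp (l * ((p * (q - x - 1 / 2) - y) / q)) - 1 -
      (q - x - y) * (1 - Real.exp (l * (-1 / q))) * (1 - η / 8) ≤ -(l * (η / 4)) := by
  have hq0 : 0 < q := by linarith
  have hl1 : l ≤ η / 128 := hl.trans (by nlinarith)
  set t := (p * (q - x - 1 / 2) - y) / q with ht
  have ht_abs : |t| ≤ 1 := by
    rw [ht, abs_div, abs_of_pos hq0, div_le_one hq0, abs_le]
    constructor <;> nlinarith
  have h1 := exp_mul_le hl₀.le (by linarith) ht_abs
  have h2 : Real.exp (l * (-1 / q)) ≤ 1 + l * (-1 / q) + (l / q) ^ 2 := by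
    have hlq : l / q ≤ l := div_le_self hl₀.le hq
    have := exp_mul_le (l := l / q) (y := -1) (by positivity) (by linarith) (by simp)
    rwa [show l * (-1 / q) = l / q * -1 by ring]
  have ht' : t * q = p * (q - x - 1 / 2) - y := div_mul_cancel₀ _ hq0.ne'
  refine ⟨by nlinarith [(abs_le.1 ht_abs).2], ?_⟩
  have hw₀ : 0 ≤ q - x - y := by linarith
  have h3 : l / q * (1 - l) ≤ 1 - Real.exp (l * (-1 / q)) := by
    have h4 : (l / q) ^ 2 ≤ l / q * l :=
      by rw [sq]; exact mul_le_mul_of_nonneg_left (div_le_self hl₀.le hq) (by positivity)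
    have h5 : l * (-1 / q) = -(l / q) := by ring
    linarith
  have h6 : (q - x - y) * (l / q * (1 - l)) * (1 - η / 8) ≤
      (q - x - y) * (1 - Real.exp (l * (-1 / q))) * (1 - η / 8) :=
    mul_le_mul_of_nonneg_right (mul_le_mul_of_nonneg_left h3 hw₀) (by linarith)
  have h7 : (q - x - y) * (l / q * (1 - l)) * (1 - η / 8) =
      l * ((1 - (x + y) / q) * ((1 - l) * (1 - η / 8))) := by
    field_simp
    ring
  -- To first order the terms `y / q` cancel and `-(1 - p)(1 - x / q) ≤ -η / 2` remains. The errors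
  -- add up to at most `2 * l + η / 8 ≤ η / 4`.
  have h8 : t + l - (1 - (x + y) / q) * ((1 - l) * (1 - η / 8)) ≤ -(η / 4) := by
    have ha : 0 ≤ 1 - (x + y) / q := by
      rw [sub_nonneg, div_le_one hq0]; linarith
    have ha' : 1 - (x + y) / q ≤ 1 := by
      rw [sub_le_self_iff]; positivity
    have hb : 1 - (l + η / 8) ≤ (1 - l) * (1 - η / 8) := by nlinarith
    have hc : t ≤ p * (1 - x / q) - y / q := by
      rw [ht, div_le_iff₀ hq0]
      have : (p * (1 - x / q) - y / q) * q = p * (q - x) - y := by field_simp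
      rw [this]
      nlinarith
    have hd : x / q ≤ 1 / 2 := by rw [div_le_iff₀ hq0]; linarith
    have he : p * (1 - x / q) ≤ (1 - η) * (1 - x / q) :=
      mul_le_mul_of_nonneg_right hp (by linarith)
    have hf := mul_le_mul_of_nonneg_left hb ha
    have hg : (1 - (x + y) / q) * (l + η / 8) ≤ l + η / 8 :=
      mul_le_of_le_one_left (by linarith) ha'
    have hh : η * (1 / 2) ≤ η * (1 - x / q) := mul_le_mul_of_nonneg_left (by linarith) hη.le
    have hi : (x + y) / q = x / q + y / q := add_div _ _ _
    nlinarith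
  have h9 := mul_le_mul_of_nonneg_left h8 hl₀.le
  nlinarith

end Position

/-! ### The invariant and its preservation -/

namespace Position

variable {n : ℕ} {q : ℕ} {δ η : ℝ}

/-- The parameters are such that the potentials change slowly. -/
structure SlowGrowth (n q : ℕ) (δ η : ℝ) : Prop where
  one_le_bias : 1 ≤ q
  pos : 0 < η
  le_one : η ≤ 1
  one_lt_potBase : 1 < potBase n q δ
  log_potBase_le : Real.log (potBase n q δ) ≤ η ^ 2 / 128
  startBalance_nonneg : 0 ≤ startBalance n q δ
  startBalance_le : startBalance n q δ ≤ 1 - η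

/-- The total alone may grow when the free edges have small potential. The term `η / 8 * m` pays for
this, since `m` then drops below the potential of Maker's edge. -/
theorem IsStrategyAnswer.potential_step (hs : SlowGrowth n q δ η) {P : Position n} (hP : P.Valid)
    (hdeg : ∀ v, 2 * P.degMaker v < q) {e : Sym2 (Fin n)} (he : e ∈ P.unclaimed)
    {R : Finset (Sym2 (Fin n))} (hR : P.IsStrategyAnswer q δ e R) {m : ℝ}
    (hm : ∀ f ∈ P.unclaimed, P.edgePot q δ f ≤ m) :
    ∃ m', 0 ≤ m' ∧ (∀ f ∈ ((P.claimMaker e).claimBreaker R).unclaimed,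
        ((P.claimMaker e).claimBreaker R).edgePot q δ f ≤ m') ∧
      ((P.claimMaker e).claimBreaker R).totalPot q δ + η / 8 * m' ≤
        P.totalPot q δ + η / 8 * m := by
  have hμ := hs.one_lt_potBase.le
  have hpos : 0 < potBase n q δ := by linarith
  have hη := hs.pos
  obtain ⟨u, v, C, rfl, hC, hcases⟩ := hR
  have huv : u ≠ v := by simpa using (mem_unclaimed.1 he).1
  have hCcard := hC.card_le
  rw [degMaker_claimMaker_of_mem he (v := u) (by simp),
    degMaker_claimMaker_of_mem he (v := v) (by simp), Nat.add_sub_cancel,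
    Nat.add_sub_cancel] at hCcard
  have hu := hdeg u
  have hv := hdeg v
  -- Part 1 fits into the bias because both Maker-degrees are below `q / 2`.
  obtain ⟨hq, F, hF, rfl⟩ := hcases.resolve_left fun h => by omega
  have hPe := hP.claimMaker he
  obtain ⟨m', hm'₀, hm', htot⟩ := hF.exists_bound hμ (hPe.claimBreaker hC.subset)
  have hFle := edgePot_claimBreaker_le (δ := δ) (q := q) hμ (hPe.claimBreaker hC.subset)
    hF.subset_and_card.1
  rw [claimBreaker_claimBreaker] at hm' htot hFle
  obtain ⟨Hu, Hv, X, hHu, hHv, -, -, hCe⟩ := id hC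
  have hpu := hHu.pot_le hμ hP he (R := C)
    (by rw [hCe]; exact Finset.subset_union_left.trans Finset.subset_union_left) hC.subset
  have hpv : ((P.claimMaker s(u, v)).claimBreaker C).pot q δ v ≤ P.pot q δ v * potBase n q δ ^
      ((startBalance n q δ * (q - P.degMaker v - 1 / 2) - P.degMaker u) / q) := by
    have hsub := hC.subset
    rw [Sym2.eq_swap] at he hHv hsub ⊢
    exact hHv.pot_le hμ hP he (R := C)
      (by rw [hCe]; exact Finset.subset_union_right.trans Finset.subset_union_left) hsub
  have hpw : ∀ w, w ≠ u → w ≠ v →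
      ((P.claimMaker s(u, v)).claimBreaker C).pot q δ w ≤ P.pot q δ w := by
    intro w hwu hwv
    refine (pot_claimBreaker_le_pot hμ hPe hC.subset w).trans_eq (pot_claimMaker_of_notMem P ?_)
    simp [hwu, hwv]
  have hmuv := hm _ he
  rw [edgePot_mk q δ P huv] at hmuv
  set A := P.pot q δ u with hA
  set B := P.pot q δ v with hB
  have hA₀ : 0 ≤ A := pot_nonneg hμ P u
  have hB₀ : 0 ≤ B := pot_nonneg hμ P v
  rw [Real.rpow_def_of_pos hpos] at hpu hpv htot
  set l := Real.log (potBase n q δ) with hl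
  have hl₀ : 0 < l := Real.log_pos hs.one_lt_potBase
  have hqR : (1 : ℝ) ≤ q := by exact_mod_cast hs.one_le_bias
  have huR : (P.degMaker u : ℝ) ≤ q / 2 := by
    have : (2 * P.degMaker u : ℝ) ≤ q := by exact_mod_cast hu.le
    linarith
  have hvR : (P.degMaker v : ℝ) ≤ q / 2 := by
    have : (2 * P.degMaker v : ℝ) ≤ q := by exact_mod_cast hv.le
    linarith
  obtain ⟨hu₁, hu₂⟩ := growth_bounds hqR hη hs.le_one hl₀ hs.log_potBase_le
    hs.startBalance_nonneg hs.startBalance_le (Nat.cast_nonneg _) huR (Nat.cast_nonneg _) hvR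
  obtain ⟨hv₁, hv₂⟩ := growth_bounds hqR hη hs.le_one hl₀ hs.log_potBase_le
    hs.startBalance_nonneg hs.startBalance_le (Nat.cast_nonneg _) hvR (Nat.cast_nonneg _) huR
  set gu := Real.exp (l * ((startBalance n q δ * (q - P.degMaker u - 1 / 2) - P.degMaker v) / q))
    with hgu
  set gv := Real.exp (l * ((startBalance n q δ * (q - P.degMaker v - 1 / 2) - P.degMaker u) / q))
    with hgv
  -- The increments may be negative. The total needs them exactly, whereas a single edge, which need
  -- not contain `u` or `v`, needs nonnegative upper bounds.
  have hnode : ∀ a b, A * (gu - 1) ≤ a → B * (gv - 1) ≤ b → ∀ w,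
      ((P.claimMaker s(u, v)).claimBreaker C).pot q δ w ≤
        P.pot q δ w + ((if w = u then a else 0) + if w = v then b else 0) := by
    intro a b ha hb w
    by_cases hwu : w = u
    · subst hwu
      rw [if_pos rfl, if_neg huv]
      linarith
    · by_cases hwv : w = v
      · subst hwv
        rw [if_neg hwu, if_pos rfl]
        linarith
      · rw [if_neg hwu, if_neg hwv]
        linarith [hpw w hwu hwv]
  have htot₁ : ((P.claimMaker s(u, v)).claimBreaker C).totalPot q δ ≤
      P.totalPot q δ + (A * (gu - 1) + B * (gv - 1)) := by
    refine (Finset.sum_le_sum fun w _ => hnode _ _ le_rfl le_rfl w).trans_eq ?_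
    simp [Finset.sum_add_distrib, totalPot]
  have hA₁ : A * (gu - 1) ≤ 2 * l * A := by nlinarith
  have hB₁ : B * (gv - 1) ≤ 2 * l * B := by nlinarith
  have hedge : ∀ f ∈ ((P.claimMaker s(u, v)).claimBreaker (C ∪ F)).unclaimed,
      ((P.claimMaker s(u, v)).claimBreaker (C ∪ F)).edgePot q δ f ≤ m + 2 * l * (A + B) := by
    intro f hf
    have hfP : f ∈ P.unclaimed := by
      rw [unclaimed_claimBreaker, Finset.mem_sdiff] at hf
      exact unclaimed_claimMaker_subset P _ hf.1
    refine (hFle f).trans ((Finset.sum_le_sum fun w _ => hnode _ _ hA₁ hB₁ w).trans ?_)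
    rw [Finset.sum_add_distrib]
    refine add_le_add (hm f hfP) ((Finset.sum_le_sum_of_subset_of_nonneg
      (Finset.subset_univ _) fun w _ _ => ?_).trans_eq ?_)
    · have : 0 ≤ 2 * l * A := by positivity
      have : 0 ≤ 2 * l * B := by positivity
      split_ifs <;> linarith
    · simp [Finset.sum_add_distrib, mul_add]
  have hz : 0 ≤ 1 - Real.exp (l * (-1 / q)) := by
    rw [sub_nonneg, Real.exp_le_one_iff]
    exact mul_nonpos_of_nonneg_of_nonpos hl₀.le
      (div_nonpos_of_nonpos_of_nonneg (by norm_num) (by linarith))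
  have hk : (q : ℝ) - P.degMaker u - P.degMaker v ≤ (q - C.card : ℕ) := by
    rw [Nat.cast_sub hq]
    have : (C.card : ℝ) ≤ P.degMaker v + P.degMaker u := by exact_mod_cast hCcard
    linarith
  have hk₀ : 0 ≤ (q : ℝ) - P.degMaker u - P.degMaker v := by linarith
  set k := (q : ℝ) - P.degMaker u - P.degMaker v with hkdef
  have hlη := hs.log_potBase_le
  have hη₁ := hs.le_one
  have hdrop₀ : 0 ≤ ((q - C.card : ℕ) : ℝ) * (1 - Real.exp (l * (-1 / q))) * m' :=
    mul_nonneg (mul_nonneg (Nat.cast_nonneg _) hz) hm'₀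
  -- If `m'` is large, the free edges lower the total by `l * (η / 4) * (A + B)` beyond the growth.
  -- This is exactly `η / 8` times the possible increase `2 * l * (A + B)` of the edge bound.
  rcases le_or_gt ((1 - η / 8) * (A + B)) m' with hcase | hcase
  · refine ⟨min m' (m + 2 * l * (A + B)), le_min hm'₀ ?_,
      fun f hf => le_min (hm' f hf) (hedge f hf), ?_⟩
    · have : 0 ≤ 2 * l * (A + B) := by positivity
      linarith
    · have hmin := mul_le_mul_of_nonneg_left (min_le_right m' (m + 2 * l * (A + B)))
        (by positivity : 0 ≤ η / 8)
      have hdrop : k * (1 - Real.exp (l * (-1 / q))) * ((1 - η / 8) * (A + B)) ≤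
          ((q - C.card : ℕ) : ℝ) * (1 - Real.exp (l * (-1 / q))) * m' :=
        (mul_le_mul_of_nonneg_left hcase (mul_nonneg hk₀ hz)).trans
          (mul_le_mul_of_nonneg_right (mul_le_mul_of_nonneg_right hk hz) hm'₀)
      have hu₃ := mul_le_mul_of_nonneg_left hu₂ hA₀
      rw [show (q : ℝ) - P.degMaker v - P.degMaker u = k by rw [hkdef]; ring] at hv₂
      have hv₃ := mul_le_mul_of_nonneg_left hv₂ hB₀
      linarith
  -- Now `m' ≤ m - η / 8 * (A + B)`, which saves `η ^ 2 / 64 * (A + B)`. The total grows by at most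
  -- `2 * l * (A + B)`, and `l ≤ η ^ 2 / 128`.
  · refine ⟨m', hm'₀, hm', ?_⟩
    have h1 : η / 8 * m' ≤ η / 8 * (m - η / 8 * (A + B)) :=
      mul_le_mul_of_nonneg_left (by linarith) (by positivity)
    have h2 : 2 * l * (A + B) ≤ η ^ 2 / 64 * (A + B) :=
      mul_le_mul_of_nonneg_right (by linarith) (by linarith)
    linarith

/-- The invariant that Breaker maintains. -/
structure Safe (q : ℕ) (δ η : ℝ) (P : Position n) : Prop where
  valid : P.Valid
  degMaker_lt : ∀ v, 2 * P.degMaker v < q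
  pathsClosed : P.PathsClosed
  exists_bound : ∃ m, 0 ≤ m ∧ (∀ f ∈ P.unclaimed, P.edgePot q δ f ≤ m) ∧
    P.totalPot q δ + η / 8 * m ≤ n + 1

theorem IsStrategyAnswer.pathsClosed {P : Position n} (hP : P.Valid) (hc : P.PathsClosed)
    (hdeg : ∀ v, 2 * P.degMaker v < q) {e : Sym2 (Fin n)} (he : e ∈ P.unclaimed)
    {R : Finset (Sym2 (Fin n))} (hR : P.IsStrategyAnswer q δ e R) :
    ((P.claimMaker e).claimBreaker R).PathsClosed := by
  obtain ⟨u, v, C, rfl, hC, hcases⟩ := hR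
  have hCcard := hC.card_le
  rw [degMaker_claimMaker_of_mem he (v := u) (by simp),
    degMaker_claimMaker_of_mem he (v := v) (by simp)] at hCcard
  have hu := hdeg u
  have hv := hdeg v
  obtain ⟨-, F, -, rfl⟩ := hcases.resolve_left fun h => by omega
  rw [← claimBreaker_claimBreaker]
  exact (hC.pathsClosed hP hc he).claimBreaker F

/-- If every node with an unclaimed edge whose Maker-degree is close to `q / 2` has a large
potential, then the answers of the strategy, possibly with additional Breaker-edges, lead from
safe positions to safe positions. -/
theorem Safe.step (hs : SlowGrowth n q δ η)
    (hbig : ∀ (P : Position n), P.Valid → ∀ e ∈ P.unclaimed, ∀ v ∈ e, 2 * P.degMaker v < q →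
      q ≤ 2 * (P.degMaker v + 1) → (n : ℝ) + 1 < P.pot q δ v)
    {P : Position n} (hP : P.Safe q δ η) {e : Sym2 (Fin n)} (he : e ∈ P.unclaimed)
    {R S : Finset (Sym2 (Fin n))} (hR : P.IsStrategyAnswer q δ e R) (hRS : R ⊆ S)
    (hS : S ⊆ (P.claimMaker e).unclaimed) :
    ((P.claimMaker e).claimBreaker S).Safe q δ η := by
  have hμ := hs.one_lt_potBase.le
  obtain ⟨m, hm₀, hm, hmn⟩ := hP.exists_bound
  have hη := hs.pos
  obtain ⟨m', hm'₀, hm', hmn'⟩ := hR.potential_step hs hP.valid hP.degMaker_lt he hm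
  have hPR := (hP.valid.claimMaker he).claimBreaker (hRS.trans hS)
  have hS' : S \ R ⊆ ((P.claimMaker e).claimBreaker R).unclaimed := by
    rw [unclaimed_claimBreaker]
    exact Finset.sdiff_subset_sdiff hS le_rfl
  have hSe : (P.claimMaker e).claimBreaker S =
      ((P.claimMaker e).claimBreaker R).claimBreaker (S \ R) := by
    rw [claimBreaker_claimBreaker, Finset.union_sdiff_of_subset hRS]
  refine ⟨(hP.valid.claimMaker he).claimBreaker hS, fun v => ?_, ?_, m', hm'₀, fun f hf => ?_, ?_⟩
  · change 2 * (P.claimMaker e).degMaker v < q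
    by_cases hv : v ∈ e
    · rw [degMaker_claimMaker_of_mem he hv]
      -- If this move made the Maker-degree reach `q / 2`, the potential of `v` before the move
      -- would already exceed the bound `n + 1` on the total.
      by_contra hlt
      have h1 := hbig P hP.valid e he v hv (hP.degMaker_lt v) (not_lt.1 hlt)
      have h2 : P.pot q δ v ≤ P.totalPot q δ :=
        Finset.single_le_sum (fun w _ => pot_nonneg hμ P w) (Finset.mem_univ v)
      have h3 : 0 ≤ η / 8 * m := by positivity
      linarith
    · rw [degMaker_claimMaker_of_notMem hv]
      exact hP.degMaker_lt v
  · rw [hSe]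
    exact (hR.pathsClosed hP.valid hP.pathsClosed hP.degMaker_lt he).claimBreaker _
  · rw [hSe] at hf ⊢
    rw [unclaimed_claimBreaker] at hf
    exact (edgePot_claimBreaker_le hμ hPR hS' f).trans (hm' f (Finset.mem_sdiff.1 hf).1)
  · rw [hSe]
    linarith [totalPot_claimBreaker_le (δ := δ) (q := q) hμ hPR hS']

theorem safe_initial (hs : SlowGrowth n q δ η)
    (hbal : startBalance n q δ * ((q : ℝ) ^ 2 * (1 - δ) * (3 + δ) / 8) = n) :
    (initial n).Safe q δ η := by
  have hpot : ∀ v, (initial n).pot q δ v ≤ 1 := by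
    intro v
    unfold pot
    split_ifs
    · exact zero_le_one
    · have : (initial n).deficit q δ v = 0 := by
        have h1 : (initial n).degMaker v = 0 := by simp [degMaker, initial]
        have h2 : (initial n).degBreaker v = 0 := by simp [degBreaker, initial]
        rw [deficit, balancedDeg, h1, h2]
        push_cast
        linarith
      simp [this]
  -- An edge has at most two ends of potential at most 1, hence `m = 2`; the surplus `η / 4` fits
  -- into the 1 in `n + 1`.
  refine ⟨valid_initial, fun v => ?_, fun u v w _ h => ?_, 2, by norm_num, fun f _ => ?_, ?_⟩
  · have : (initial n).degMaker v = 0 := by simp [degMaker, initial]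
    have := hs.one_le_bias
    omega
  · simp [initial] at h
  · refine (Finset.sum_le_card_nsmul _ _ 1 fun v _ => hpot v).trans ?_
    rw [Sym2.card_toFinset]
    split_ifs <;> norm_num
  · have h1 : (initial n).totalPot q δ ≤ n := by
      refine (Finset.sum_le_card_nsmul Finset.univ _ 1 fun v _ => hpot v).trans_eq ?_
      simp
    linarith [hs.le_one]

end Position

/-! ### From single answers to strategies and plays -/

namespace BreakerStrategy

open Position

variable {n : ℕ}

/-- Requiring only that `σ` contains an answer of the strategy covers both the exact strategy and
its extensions for a larger bias. -/
theorem IsPlay.position_safe {q : ℕ} {δ η : ℝ} (hs : SlowGrowth n q δ η)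
    (hbig : ∀ (P : Position n), P.Valid → ∀ e ∈ P.unclaimed, ∀ v ∈ e, 2 * P.degMaker v < q →
      q ≤ 2 * (P.degMaker v + 1) → (n : ℝ) + 1 < P.pot q δ v)
    (hinit : (initial n).Safe q δ η) {σ : BreakerStrategy n}
    (hσ : ∀ h e, σ.IsPlay (e :: h) → σ (e :: h) ⊆ ((σ.position h).claimMaker e).unclaimed ∧
      ∃ R ⊆ σ (e :: h), (σ.position h).IsStrategyAnswer q δ e R)
    {h : List (Sym2 (Fin n))} (hh : σ.IsPlay h) : (σ.position h).Safe q δ η := by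
  induction h with
  | nil => exact hinit
  | cons e h ih =>
    obtain ⟨hS, R, hRS, hR⟩ := hσ h e hh
    exact (ih hh.1).step hs hbig hh.2 hR hRS hS

/-- The strategy that answers Maker's edge `e` in the position `P` by `f P e`. -/
def ofAnswer (f : Position n → Sym2 (Fin n) → Finset (Sym2 (Fin n))) :
    List (Sym2 (Fin n)) → Finset (Sym2 (Fin n)) × Position n
  | [] => (∅, initial n)
  | e :: h => (f (ofAnswer f h).2 e,
      (((ofAnswer f h).2).claimMaker e).claimBreaker (f (ofAnswer f h).2 e))

/-- The position depends on the strategy being defined, so the recursion computes answer and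
position simultaneously. -/
theorem exists_of_answer (f : Position n → Sym2 (Fin n) → Finset (Sym2 (Fin n))) :
    ∃ σ : BreakerStrategy n, ∀ h e, σ (e :: h) = f (σ.position h) e := by
  refine ⟨fun h => (ofAnswer f h).1, fun h e => ?_⟩
  suffices hp : ∀ h, position (fun h => (ofAnswer f h).1) h = (ofAnswer f h).2 by
    rw [hp]
    rfl
  intro h
  induction h with
  | nil => rfl
  | cons e h ih =>
    change ((position _ h).claimMaker e).claimBreaker _ = _
    rw [ih]
    rfl

theorem exists_followsPotential (n q : ℕ) (δ : ℝ) :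
    ∃ σ : BreakerStrategy n, σ.FollowsPotential q δ := by
  choose f hf using fun P : Position n => IsStrategyAnswer.exists q δ P
  obtain ⟨σ, hσ⟩ := exists_of_answer f
  refine ⟨σ, fun h e _ => ?_⟩
  rw [hσ]
  exact hf _ _

/-- With a larger bias, Breaker can extend the answers of the potential-based strategy. -/
theorem exists_extends_potential (n : ℕ) {q q' : ℕ} (hq : q ≤ q') (δ : ℝ) :
    ∃ σ : BreakerStrategy n, σ.IsLegal q' ∧
      ∀ h e, ∃ R ⊆ σ (e :: h), (σ.position h).IsStrategyAnswer q δ e R := by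
  have key : ∀ (P : Position n) (e : Sym2 (Fin n)), ∃ S, S ⊆ (P.claimMaker e).unclaimed ∧
      S.card = min q' (P.claimMaker e).unclaimed.card ∧
      ∃ R ⊆ S, P.IsStrategyAnswer q δ e R := by
    intro P e
    obtain ⟨R, hR⟩ := IsStrategyAnswer.exists q δ P e
    obtain ⟨h1, h2⟩ := hR.subset_and_card
    obtain ⟨S, hRS, hS, hSc⟩ := Finset.exists_subsuperset_card_eq h1
      (n := min q' (P.claimMaker e).unclaimed.card) (by omega) (min_le_right _ _)
    exact ⟨S, hS, hSc, R, hRS, hR⟩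
  choose f hf₁ hf₂ hf₃ using key
  obtain ⟨σ, hσ⟩ := exists_of_answer f
  refine ⟨σ, fun h e _ => ?_, fun h e => ?_⟩
  · rw [hσ]
    exact ⟨hf₁ _ _, hf₂ _ _⟩
  · rw [hσ]
    exact hf₃ _ _

end BreakerStrategy

/-! ### Estimates for the parameters and large `n` -/

namespace Position

variable {n : ℕ} {q : ℕ} {δ η : ℝ}

theorem startBalance_mul (hn : 0 < n) (hq : 0 < q) (hδ₀ : 0 < δ) (hδ₁ : δ < 1) :
    startBalance n q δ * ((q : ℝ) ^ 2 * (1 - δ) * (3 + δ) / 8) = n := by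
  have h1 : 1 - δ ≠ 0 := by linarith
  have h2 : 3 + δ ≠ 0 := by linarith
  have h3 : (q : ℝ) ≠ 0 := by positivity
  unfold startBalance
  field_simp

/-- For `x` within 1 of `q / 2`, the term `x (q - x / 2)` is `3q² / 8` up to an error of at most
`q`. The choice of `p₀` and `(1 + 2δ/3)(1 - δ)(3 + δ) ≤ 3` turn this into at least `(1 + 2δ/3) n -
q`, while the Breaker-degree is at most `n`. -/
theorem deficit_ge (hn : 0 < n) (hq : 0 < q) (hδ₀ : 0 < δ) (hδ₁ : δ < 1)
    (hp₀ : 0 ≤ startBalance n q δ) (hp₁ : startBalance n q δ ≤ 1) {P : Position n}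
    (hP : P.Valid) {v : Fin n} (hlt : 2 * P.degMaker v < q) (hge : q ≤ 2 * (P.degMaker v + 1)) :
    2 * δ / 3 * n - q ≤ P.deficit q δ v := by
  have hbal := startBalance_mul hn hq hδ₀ hδ₁
  have hB : (P.degBreaker v : ℝ) ≤ n := by
    have := hP.degree_sum v
    exact_mod_cast (by omega : P.degBreaker v ≤ n)
  have hx₁ : 2 * (P.degMaker v : ℝ) ≤ q := by exact_mod_cast hlt.le
  have hx₂ : (q : ℝ) ≤ 2 * (P.degMaker v + 1) := by exact_mod_cast hge
  have hqR : (1 : ℝ) ≤ q := by exact_mod_cast hq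
  rw [deficit, balancedDeg, mul_sub, hbal]
  set p := startBalance n q δ
  set x := (P.degMaker v : ℝ)
  have h1 : 3 * (q : ℝ) ^ 2 / 8 - q ≤ x * (q - x / 2) := by
    have := mul_nonneg (by linarith : 0 ≤ x - (q / 2 - 1))
      (by linarith : 0 ≤ (q : ℝ) - (x + q / 2 - 1) / 2)
    nlinarith
  have h2 := mul_le_mul_of_nonneg_left h1 hp₀
  have h3 : (1 + 2 * δ / 3) * ((1 - δ) * (3 + δ)) ≤ 3 := by
    have := pow_pos hδ₀ 2
    have := pow_pos hδ₀ 3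
    nlinarith
  have h4 := mul_le_mul_of_nonneg_left h3 (by positivity : 0 ≤ p * (q : ℝ) ^ 2 / 8)
  have h5 : p * q ≤ q := mul_le_of_le_one_left (by linarith) hp₁
  have h6 : p * (q : ℝ) ^ 2 / 8 * ((1 + 2 * δ / 3) * ((1 - δ) * (3 + δ))) =
      (1 + 2 * δ / 3) * n := by
    rw [← hbal]
    ring
  linarith

/-- The constant 6 in `μ = 1 + y` is chosen so that `log μ ≥ y / 2` and a deficit of `2δn/3 - q`
give an exponent of at least `2 log n - 1/2`. The potential is then at least `n² / 2`, which exceeds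
`n + 1` for `n ≥ 3`. -/
theorem lt_pot_of_le_degMaker (hs : SlowGrowth n q δ η) (hn : 3 ≤ n) (hδ₀ : 0 < δ) (hδ₁ : δ < 1)
    (hy : 6 * ratio n q * Real.log n / (δ * q) ≤ 1) {P : Position n} (hP : P.Valid)
    {e : Sym2 (Fin n)} (he : e ∈ P.unclaimed) {v : Fin n} (hv : v ∈ e)
    (hlt : 2 * P.degMaker v < q) (hge : q ≤ 2 * (P.degMaker v + 1)) :
    (n : ℝ) + 1 < P.pot q δ v := by
  have hd := deficit_ge (by omega) hs.one_le_bias hδ₀ hδ₁ hs.startBalance_nonneg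
    (hs.startBalance_le.trans (by linarith [hs.pos])) hP hlt hge
  have hμ := hs.one_lt_potBase
  rw [pot_eq_rpow hP he hv, Real.rpow_def_of_pos (by linarith)]
  set d := P.deficit q δ v
  set y := 6 * ratio n q * Real.log n / (δ * q) with hydef
  have hμy : potBase n q δ = 1 + y := rfl
  have hnR : (3 : ℝ) ≤ n := by exact_mod_cast hn
  have hn₀ : (0 : ℝ) < n := by linarith
  have hqR : (1 : ℝ) ≤ q := by exact_mod_cast hs.one_le_bias
  have hq₀ : (0 : ℝ) < q := by linarith
  have hy₀ : 0 < y := by linarith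
  have hlog : 1 ≤ Real.log n := by
    rw [Real.le_log_iff_exp_le hn₀]
    linarith [Real.exp_one_lt_three]
  have hyn : y * (δ * n) = 6 * q * Real.log n := by
    rw [hydef, ratio]
    field_simp
  -- From `y ≤ 1` and `log n ≥ 1` it follows that `6q ≤ δn`, so the deficit bound is nonnegative.
  have hd₀ : 0 ≤ d := by
    have h1 : y * (δ * n) ≤ δ * n := mul_le_of_le_one_left (by positivity) hy
    have h2 : 6 * q * 1 ≤ 6 * q * Real.log n := mul_le_mul_of_nonneg_left hlog (by positivity)
    nlinarith
  have hly : y / 2 ≤ Real.log (potBase n q δ) := by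
    rw [hμy]
    refine le_trans ?_ (Real.le_log_one_add_of_nonneg hy₀.le)
    rw [le_div_iff₀ (by linarith)]
    nlinarith
  have hexp : 2 * Real.log n - 1 / 2 ≤ Real.log (potBase n q δ) * (d / q) := by
    refine le_trans ?_ (mul_le_mul_of_nonneg_right hly (by positivity))
    have h1 : (y / 2) * ((2 * δ / 3 * n - q) / q) ≤ y / 2 * (d / q) :=
      mul_le_mul_of_nonneg_left (div_le_div_of_nonneg_right hd hq₀.le) (by positivity)
    have h2 : (y / 2) * ((2 * δ / 3 * n - q) / q) = y * (δ * n) / (3 * q) - y / 2 := by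
      field_simp
    have h3 : y * (δ * n) / (3 * q) = 2 * Real.log n := by
      rw [hyn]
      field_simp
      norm_num
    linarith
  refine lt_of_lt_of_le ?_ (Real.exp_le_exp.2 hexp)
  have h1 : Real.exp (2 * Real.log n - 1 / 2) = (n : ℝ) ^ 2 * Real.exp (-(1 / 2)) := by
    rw [sub_eq_add_neg, Real.exp_add, two_mul, Real.exp_add, Real.exp_log hn₀, sq]
  have h2 : (1 : ℝ) / 2 ≤ Real.exp (-(1 / 2)) := by
    have := Real.add_one_le_exp (-(1 / 2) : ℝ)
    linarith
  rw [h1]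
  have h3 := mul_le_mul_of_nonneg_left h2 (sq_nonneg (n : ℝ))
  nlinarith

/-- The upper bound on `δ` says that `(8/3 + ε)(1 - δ) > 8/3`. Hence `p₀ ≤ 3 / (3 + δ)`, which is at
most `1 - δ / 4`. -/
theorem startBalance_le_of_sqrt_le {ε : ℝ} (hε : 0 < ε) (hδ₀ : 0 < δ)
    (hδ₁ : δ < 1 - 8 / (3 * (8 / 3 + ε))) (hn : 0 < n) (hq : √((8 / 3 + ε) * n) ≤ q) :
    startBalance n q δ ≤ 1 - δ / 4 := by
  have hδ : δ < 1 := hδ₁.trans (sub_lt_self _ (by positivity))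
  have hn₀ : (0 : ℝ) < n := by exact_mod_cast hn
  have hq₂ : (8 / 3 + ε) * n ≤ (q : ℝ) ^ 2 := (Real.sqrt_le_left (by positivity)).1 hq
  have h1 : 8 / 3 ≤ (8 / 3 + ε) * (1 - δ) := by
    have h2 : 8 / (3 * (8 / 3 + ε)) ≤ 1 - δ := by linarith
    rw [div_le_iff₀ (by positivity)] at h2
    linarith
  have h3 : 8 / 3 * n ≤ (q : ℝ) ^ 2 * (1 - δ) := by
    have h4 := mul_le_mul_of_nonneg_right hq₂ (by linarith : 0 ≤ 1 - δ)
    have h5 := mul_le_mul_of_nonneg_right h1 hn₀.le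
    linarith
  have h6 : 0 < (q : ℝ) ^ 2 * (1 - δ) := by
    have : 0 < 8 / 3 * (n : ℝ) := by positivity
    linarith
  rw [startBalance, div_le_iff₀ (by positivity)]
  have h7 : 0 ≤ (1 - δ / 4) * (3 + δ) := by nlinarith
  have h8 := mul_le_mul_of_nonneg_right h3 h7
  have h9 : 3 ≤ (1 - δ / 4) * (3 + δ) := by nlinarith
  nlinarith

theorem eventually_log_le {c : ℝ} (hc : 0 < c) :
    ∃ N : ℕ, ∀ n : ℕ, N ≤ n → Real.log n ≤ c * √n := by
  have h := ((isLittleO_log_rpow_atTop (by norm_num : (0 : ℝ) < 1 / 2)).def hc).natCast_atTop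
  obtain ⟨N, hN⟩ := Filter.eventually_atTop.1 h
  refine ⟨N, fun n hn => (le_abs_self _).trans ?_⟩
  have := hN n hn
  rwa [← Real.sqrt_eq_rpow, Real.norm_eq_abs, Real.norm_of_nonneg (Real.sqrt_nonneg _)] at this

theorem eventually_slowGrowth {ε : ℝ} (hε : 0 < ε) (hδ₀ : 0 < δ)
    (hδ₁ : δ < 1 - 8 / (3 * (8 / 3 + ε))) (K : ℝ) :
    ∃ N : ℕ, 3 ≤ N ∧ ∀ n : ℕ, N ≤ n → ∀ q : ℕ, √((8 / 3 + ε) * n) ≤ q → (q : ℝ) ≤ K * √n →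
      SlowGrowth n q δ (δ / 4) ∧ 6 * ratio n q * Real.log n / (δ * q) ≤ 1 := by
  have hδ : δ < 1 := hδ₁.trans (sub_lt_self _ (by positivity))
  have hK : 0 < max K 1 := lt_max_of_lt_right one_pos
  -- With `η = δ / 4`, the bound `η ^ 2 / 128` is `δ ^ 2 / 2048`. Since `μ - 1 = 6 q log n / (δ n)`,
  -- the constant is `12288 = 6 * 2048`. The maximum with 1 keeps the denominator positive.
  obtain ⟨N, hN⟩ := eventually_log_le (c := δ ^ 3 / (12288 * max K 1)) (by positivity)
  refine ⟨max N 3, le_max_right _ _, fun n hn q hq hqK => ?_⟩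
  have hn₃ : 3 ≤ n := (le_max_right _ _).trans hn
  have hnR : (3 : ℝ) ≤ n := by exact_mod_cast hn₃
  have hn₀ : (0 : ℝ) < n := by linarith
  have hq₀ : (0 : ℝ) < q := lt_of_lt_of_le (Real.sqrt_pos.2 (by positivity)) hq
  have hlog := hN n ((le_max_left _ _).trans hn)
  have hlog₀ : 0 < Real.log n := Real.log_pos (by linarith)
  have hy : 6 * ratio n q * Real.log n / (δ * q) ≤ δ ^ 2 / 2048 := by
    have h1 : 6 * ratio n q * Real.log n / (δ * q) = 6 * (q * Real.log n) / (δ * n) := by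
      rw [ratio]
      field_simp
    have h2 : q * Real.log n ≤ max K 1 * √n * (δ ^ 3 / (12288 * max K 1) * √n) :=
      mul_le_mul (hqK.trans (mul_le_mul_of_nonneg_right (le_max_left _ _) (Real.sqrt_nonneg _)))
        hlog hlog₀.le (by positivity)
    have h3 : max K 1 * √n * (δ ^ 3 / (12288 * max K 1) * √n) = δ ^ 3 / 12288 * n := by
      have := Real.mul_self_sqrt hn₀.le
      calc _ = δ ^ 3 / 12288 * (√n * √n) := by field_simp
        _ = _ := by rw [this]
    rw [h1, div_le_iff₀ (by positivity)]
    linarith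
  have hy₀ : 0 < 6 * ratio n q * Real.log n / (δ * q) := by
    rw [ratio]
    positivity
  refine ⟨⟨by exact_mod_cast hq₀, by linarith, by linarith, ?_, ?_, ?_, ?_⟩, hy.trans (by nlinarith)⟩
  · rw [potBase]
    linarith
  · have h := Real.log_le_sub_one_of_pos (x := potBase n q δ) (by rw [potBase]; linarith)
    rw [potBase] at h ⊢
    refine h.trans (le_trans (by linarith) (hy.trans (le_of_eq ?_)))
    ring
  · rw [startBalance]
    have : 0 < 1 - δ := by linarith
    positivity
  · exact startBalance_le_of_sqrt_le hε hδ₀ hδ₁ (by omega) hq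

end Position

open Position in
theorem BreakerStrategy.eventually_position_safe {ε δ : ℝ} (hε : 0 < ε) (hδ₀ : 0 < δ)
    (hδ₁ : δ < 1 - 8 / (3 * (8 / 3 + ε))) (K : ℝ) :
    ∃ N : ℕ, 3 ≤ N ∧ ∀ n : ℕ, N ≤ n → ∀ q : ℕ, √((8 / 3 + ε) * n) ≤ q → (q : ℝ) ≤ K * √n →
      ∀ σ : BreakerStrategy n,
        (∀ h e, σ.IsPlay (e :: h) → σ (e :: h) ⊆ ((σ.position h).claimMaker e).unclaimed ∧
          ∃ R ⊆ σ (e :: h), (σ.position h).IsStrategyAnswer q δ e R) →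
        ∀ h, σ.IsPlay h → (σ.position h).Safe q δ (δ / 4) := by
  have hδ : δ < 1 := hδ₁.trans (sub_lt_self _ (by positivity))
  obtain ⟨N, hN₃, hN⟩ := eventually_slowGrowth hε hδ₀ hδ₁ K
  refine ⟨N, hN₃, fun n hn q hq hqK σ hσ h hh => ?_⟩
  obtain ⟨hs, hy⟩ := hN n hn q hq hqK
  exact IsPlay.position_safe hs
    (fun P hP e he v hv => lt_pot_of_le_degMaker hs (by omega) hδ₀ hδ hy hP he hv)
    (safe_initial hs (startBalance_mul (by omega) hs.one_le_bias hδ₀ hδ)) hσ hh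

end TriangleGame

theorem theorem2 (ε : ℝ) (hε : 0 < ε) (δ : ℝ) (hδ₀ : 0 < δ)
    (hδ₁ : δ < 1 - 8 / (3 * (8 / 3 + ε))) (K : ℝ) :
    ∃ N : ℕ, ∀ n : ℕ, N ≤ n →
      (∀ q : ℕ, √((8 / 3 + ε) * n) ≤ q → (q : ℝ) ≤ K * √n →
        (∃ σ : TriangleGame.BreakerStrategy n, σ.FollowsPotential q δ) ∧
        ∀ σ : TriangleGame.BreakerStrategy n, σ.FollowsPotential q δ →
          (∀ h, σ.IsCompletePlay h → ∀ v : Fin n, ¬ ((q : ℝ) / 2 ≤ (σ.position h).degMaker v)) ∧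
          σ.IsWinning q) ∧
      ∀ q : ℕ, √((8 / 3 + ε) * n) ≤ q → TriangleGame.BreakerWins n q := by
  obtain ⟨N₁, -, hN₁⟩ := TriangleGame.BreakerStrategy.eventually_position_safe hε hδ₀ hδ₁ K
  -- For part (ii) the underlying bias is `⌈√((8 / 3 + ε) * n)⌉₊`; this constant bounds it, as
  -- rounding up costs at most `1 ≤ √n`.
  obtain ⟨N₂, hN₂₃, hN₂⟩ := TriangleGame.BreakerStrategy.eventually_position_safe hε hδ₀ hδ₁
    (√(8 / 3 + ε) + 1)
  refine ⟨max N₁ N₂, fun n hn => ⟨fun q hq hqK => ⟨?_, fun σ hσ => ?_⟩, fun q hq => ?_⟩⟩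
  · exact TriangleGame.BreakerStrategy.exists_followsPotential n q δ
  · have hlegal : σ.IsLegal q := fun h e hh => (hσ h e hh).subset_and_card
    have hsafe := hN₁ n ((le_max_left _ _).trans hn) q hq hqK σ
      fun h e hh => ⟨(hlegal h e hh).1, _, subset_rfl, hσ h e hh⟩
    refine ⟨fun h hh v => ?_, hlegal, fun h hh => ?_⟩
    · have hlt : (2 * (σ.position h).degMaker v : ℝ) < q := by
        exact_mod_cast (hsafe h hh.1).degMaker_lt v
      rw [not_le]
      linarith
    · exact (hsafe h hh.1).pathsClosed.not_hasMakerTriangle (hsafe h hh.1).valid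
  · obtain ⟨σ, hlegal, hσ⟩ :=
      TriangleGame.BreakerStrategy.exists_extends_potential n (Nat.ceil_le.2 hq) δ
    have hn₁ : (1 : ℝ) ≤ √n := by
      rw [Real.one_le_sqrt]
      have := le_max_right N₁ N₂
      exact_mod_cast (by omega : 1 ≤ n)
    have hceil : (⌈√((8 / 3 + ε) * n)⌉₊ : ℝ) ≤ (√(8 / 3 + ε) + 1) * √n := by
      refine (Nat.ceil_lt_add_one (Real.sqrt_nonneg _)).le.trans ?_
      rw [Real.sqrt_mul (by positivity), add_mul]
      linarith
    have hsafe := hN₂ n ((le_max_right _ _).trans hn) _ (Nat.le_ceil _) hceil σ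
      fun h e hh => ⟨(hlegal h e hh).1, hσ h e⟩
    exact ⟨σ, hlegal, fun h hh =>
      (hsafe h hh.1).pathsClosed.not_hasMakerTriangle (hsafe h hh.1).valid⟩
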